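/- Let $0\le k\le n$. Let $\mathcal W_n$ be the hyperoctahedral group of permutations $w$ of $\{-n,\dots,n\}$ with $w(-i)=-w(i)$ for all $i$, written in one-line notation $w(1)\cdots w(n)$ with $\bar a=-a$, and generated by the simple reflections $s_0=(\bar 1,1)$ and $s_i=(\overline{i+1},\bar i)(i,i+1)$ for $1\le i\le n-1$. Let $\ell$ be the length with respect to these generators. Write $w'\le w$ in the Bruhat order if $w'$ is the product of a subword of a reduced decomposition of $w$, and say that $w$ covers $w'$ if $w'\le w$ and $\ell(w)=\ell(w')+1$. Let $\mathcal W_n^{(k)}$ be the set of $w\in\mathcal W_n$ such that $\ell(w)<\ell(ws_i)$ for all $0\le i\le n-1$ with $i\neq k$. Its elements have the form $$w=u_1\cdots u_k\,|\,\overline{\lambda_r}\cdots\overline{\lambda_1}\,v_1\cdots v_{n-k-r},$$ where $0<u_1<\dots<u_k$, $0<\lambda_1<\dots<\lambda_r$ and $0<v_1<\dots<v_{n-k-r}$. Let $w\in\mathcal W_n^{(k)}$. In each of the following cases the signed permutation $w'$, obtained from $w$ by replacing the indicated entries in their positions and leaving all other entries among $w(1),\dots,w(n)$ unchanged, belongs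 to $\mathcal W_n^{(k)}$ and is covered by $w$: 1. if $1$ is one of the $\lambda$'s, $w=\cdots|\cdots\bar 1\cdots$, then $w'=\cdots|\cdots 1\cdots$; 2. if $a\geq 2$ is one of the $\lambda$'s and $a-1$ is one of the $v$'s, $w=\cdots|\cdots\bar a\cdots(a-1)\cdots$, then $w'=\cdots|\cdots\overline{a-1}\cdots a\cdots$; 3. if $a$ is one of the $u$'s, $b<a$ is one of the $v$'s, and all integers $b+1,\dots,a-1$ are among the $\lambda$'s, $w=\cdots a\cdots|\cdots b\cdots$, then $w'=\cdots b\cdots|\cdots a\cdots$; 4. if $b$ is one of the $u$'s, $a>b$ is one of the $\lambda$'s, and all integers $b+1,\dots,a-1$ are among the $v$'s, $w=\cdots b\cdots|\cdots\bar a\cdots$, then $w'=\cdots a\cdots|\cdots\bar b\cdots$. Conversely, every $w'\in\mathcal W_n^{(k)}$ covered by $w$ arises from $w$ in one of these four ways. -/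

import Mathlib

namespace TypeB

/-- The hyperoctahedral group: permutations `w` of `{-n, …, n}` with `w (-i) = -w i`, each
extended by the identity to all of `ℤ`. Multiplication is composition, `(v * w) i = v (w i)`. -/
def hyperoctahedral (n : ℕ) : Subgroup (Equiv.Perm ℤ) where
  carrier := {w | (∀ i, w (-i) = -w i) ∧ ∀ i : ℤ, (n : ℤ) < |i| → w i = i}
  mul_mem' := by
    rintro v w ⟨hv, hv'⟩ ⟨hw, hw'⟩
    refine ⟨fun i => by simp [hw, hv], fun i hi => by simp [hw' i hi, hv' i hi]⟩
  one_mem' := ⟨fun _ => rfl, fun _ _ => rfl⟩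
  inv_mem' := by
    rintro w ⟨hw, hw'⟩
    refine ⟨fun i => ?_, fun i hi => ?_⟩
    · rw [Equiv.Perm.inv_eq_iff_eq, hw]; simp
    · rw [Equiv.Perm.inv_eq_iff_eq, hw' i hi]

/-- The simple reflections `s_0 = (-1, 1)` and `s_i = (-(i+1), -i) (i, i+1)` for `i ≥ 1`. -/
def simpleReflection (i : ℕ) : Equiv.Perm ℤ :=
  if i = 0 then Equiv.swap (-1) 1
  else Equiv.swap (-((i : ℤ) + 1)) (-(i : ℤ)) * Equiv.swap (i : ℤ) ((i : ℤ) + 1)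

/-- The product `s_{i_1} ⋯ s_{i_m}` of a word `[i_1, …, i_m]`. -/
def wordProd (l : List ℕ) : Equiv.Perm ℤ := (l.map simpleReflection).prod

/-- `l` is a decomposition of `w` in the generators `s_0, …, s_{n-1}`. -/
def IsWord (n : ℕ) (l : List ℕ) (w : Equiv.Perm ℤ) : Prop :=
  (∀ i ∈ l, i < n) ∧ wordProd l = w

/-- The length of `w`: the minimal number of simple reflections in a decomposition of `w`. -/
noncomputable def length (n : ℕ) (w : Equiv.Perm ℤ) : ℕ :=
  sInf {m | ∃ l : List ℕ, IsWord n l w ∧ l.length = m}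

/-- `l` is a reduced decomposition of `w`. -/
def IsReducedWord (n : ℕ) (l : List ℕ) (w : Equiv.Perm ℤ) : Prop :=
  IsWord n l w ∧ l.length = length n w

/-- The Bruhat order `w' ≤ w`: `w'` is the product of a subword of a reduced decomposition
of `w`. -/
def BruhatLE (n : ℕ) (w' w : Equiv.Perm ℤ) : Prop :=
  ∃ l : List ℕ, IsReducedWord n l w ∧ ∃ l' : List ℕ, l'.Sublist l ∧ wordProd l' = w'

/-- `w` covers `w'`. -/
def Covers (n : ℕ) (w w' : Equiv.Perm ℤ) : Prop :=
  BruhatLE n w' w ∧ length n w = length n w' + 1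

/-- The `k`-Grassmannian permutations: the minimal length representatives of the cosets of the
parabolic subgroup generated by the `s_i` with `i ≠ k`. -/
def grassmannian (n k : ℕ) : Set (Equiv.Perm ℤ) :=
  {w | w ∈ hyperoctahedral n ∧
    ∀ i : ℕ, i < n → i ≠ k → length n w < length n (w * simpleReflection i)}

/-- The set of the `λ`'s of `w`: absolute values of the negative entries after position `k`. -/
def lambdaSet (n k : ℕ) (w : Equiv.Perm ℤ) : Set ℤ :=
  {a | 0 < a ∧ ∃ i ∈ Set.Ioc (k : ℤ) n, w i = -a}

/-- The set of the `v`'s of `w`: the positive entries after position `k`. -/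
def vSet (n k : ℕ) (w : Equiv.Perm ℤ) : Set ℤ :=
  {a | 0 < a ∧ ∃ i ∈ Set.Ioc (k : ℤ) n, w i = a}

/-- `w'` is the signed permutation with one-line notation `f 1, f 2, …, f n`. -/
def HasOneLine (n : ℕ) (w' : Equiv.Perm ℤ) (f : ℤ → ℤ) : Prop :=
  w' ∈ hyperoctahedral n ∧ ∀ m ∈ Set.Icc (1 : ℤ) n, w' m = f m

/-- Local pattern 1, at position `i`: an entry `-1` after position `k`. -/
def Pattern1 (n k : ℕ) (w : Equiv.Perm ℤ) (i : ℤ) : Prop :=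
  i ∈ Set.Ioc (k : ℤ) n ∧ w i = -1

/-- Local pattern 2, at positions `i`, `j`: entries `-a` and `a - 1 > 0` after position `k`. -/
def Pattern2 (n k : ℕ) (w : Equiv.Perm ℤ) (i j a : ℤ) : Prop :=
  i ∈ Set.Ioc (k : ℤ) n ∧ j ∈ Set.Ioc (k : ℤ) n ∧ 0 < a - 1 ∧ w i = -a ∧ w j = a - 1

/-- Local pattern 3, at positions `i`, `j`: `a` is one of the `u`'s, `b < a` is one of the
`v`'s, and all values strictly between them are among the `λ`'s. -/
def Pattern3 (n k : ℕ) (w : Equiv.Perm ℤ) (i j a b : ℤ) : Prop :=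
  i ∈ Set.Icc (1 : ℤ) k ∧ j ∈ Set.Ioc (k : ℤ) n ∧ 0 < b ∧ b < a ∧ w i = a ∧ w j = b ∧
    ∀ c ∈ Set.Ioo b a, c ∈ lambdaSet n k w

/-- Local pattern 4, at positions `i`, `j`: `b` is one of the `u`'s, `a > b` is one of the
`λ`'s, and all values strictly between them are among the `v`'s. -/
def Pattern4 (n k : ℕ) (w : Equiv.Perm ℤ) (i j a b : ℤ) : Prop :=
  i ∈ Set.Icc (1 : ℤ) k ∧ j ∈ Set.Ioc (k : ℤ) n ∧ 0 < b ∧ b < a ∧ w i = b ∧ w j = -a ∧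
    ∀ c ∈ Set.Ioo b a, c ∈ vSet n k w

/-- The one-line notation of `w` with the entry at position `i` replaced by `x`. -/
def replaceOne (w : Equiv.Perm ℤ) (i x : ℤ) : ℤ → ℤ := Function.update (⇑w) i x

/-- The one-line notation of `w` with the entries at positions `i`, `j` replaced by `x`, `y`. -/
def replaceTwo (w : Equiv.Perm ℤ) (i x j y : ℤ) : ℤ → ℤ :=
  Function.update (Function.update (⇑w) i x) j y

end TypeB

/-! Reflections act by left multiplication, that is, on values. By strong exchange
(`exists_wordProd_eq_refl_mul`), if `p < q` and `w⁻¹ q < w⁻¹ p`, then `refl p q * w` arises by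
deleting a letter from any word of `w`. Hence it lies below `w` and is shorter (`exchange`), and
every length comparison becomes a comparison of positions. In particular `grassmannian n k` consists
of the `w` that increase on the blocks `[0, k]` and `(k, n]`.

For the four patterns the reflection preserves the order inside each block, and
`length_le_length_refl_mul` bounds the drop in length by one when no intermediate value stands
between the two exchanged ones.

Conversely, a cover deletes exactly one letter, so `w' = refl p q * w`. In each of the three
families of reflections, monotonicity of `w` and `w'` on the blocks leaves the listed patterns and a
few other configurations. In those the reflection is a conjugate `r * s * r` whose three factors
each lower the length, so the drop is at least three (`length_refl_conj_mul_add_three_le`). -/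

namespace TypeB

/-! ### Reflections acting on values -/

/-- The reflection of the hyperoctahedral group exchanging `p` with `q` and `-p` with `-q`. -/
def refl (p q : ℤ) : Equiv.Perm ℤ :=
  -- For `p = -q` the two transpositions coincide and their product would be trivial.
  if p = -q then Equiv.swap p q else Equiv.swap p q * Equiv.swap (-p) (-q)

theorem refl_apply {p q : ℤ} (hp : p ≠ 0) (hq : q ≠ 0) (x : ℤ) :
    refl p q x = if x = p then q else if x = q then p else
      if x = -p then -q else if x = -q then -p else x := by
  unfold refl
  split_ifs <;> simp only [Equiv.Perm.mul_apply, Equiv.swap_apply_def] <;> split_ifs <;> omega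

theorem refl_mul_self {p q : ℤ} (hp : p ≠ 0) (hq : q ≠ 0) : refl p q * refl p q = 1 := by
  ext x
  simp only [Equiv.Perm.mul_apply, refl_apply hp hq, Equiv.Perm.one_apply]
  split_ifs <;> omega

theorem refl_inv {p q : ℤ} (hp : p ≠ 0) (hq : q ≠ 0) : (refl p q)⁻¹ = refl p q :=
  inv_eq_of_mul_eq_one_left (refl_mul_self hp hq)

theorem refl_neg {p q : ℤ} (hp : p ≠ 0) (hq : q ≠ 0) (x : ℤ) : refl p q (-x) = -refl p q x := by
  simp only [refl_apply hp hq]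
  split_ifs <;> omega

theorem refl_comm {p q : ℤ} (hp : p ≠ 0) (hq : q ≠ 0) : refl p q = refl q p := by
  ext x
  simp only [refl_apply hp hq, refl_apply hq hp]
  split_ifs <;> omega

theorem refl_neg_neg {p q : ℤ} (hp : p ≠ 0) (hq : q ≠ 0) : refl (-p) (-q) = refl p q := by
  ext x
  simp only [refl_apply hp hq, refl_apply (neg_ne_zero.2 hp) (neg_ne_zero.2 hq)]
  split_ifs <;> omega

/-- Conjugating a reflection relabels the exchanged values. This turns right multiplication into
left multiplication and moves a reflection past a letter of a word. -/
theorem mul_refl {x : Equiv.Perm ℤ} (hx : ∀ i, x (-i) = -x i) (p q : ℤ) :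
    x * refl p q = refl (x p) (x q) * x := by
  have h : x p = -x q ↔ p = -q := by rw [← hx, x.apply_eq_iff_eq]
  unfold refl
  simp only [h]
  split_ifs
  · rw [Equiv.swap_apply_apply, inv_mul_cancel_right]
  · rw [← hx, ← hx, Equiv.swap_apply_apply, Equiv.swap_apply_apply]
    group

theorem simpleReflection_zero : simpleReflection 0 = refl (-1) 1 := by
  simp [simpleReflection, refl]

theorem simpleReflection_pos {i : ℕ} (hi : 0 < i) :
    simpleReflection i = refl (i : ℤ) (i + 1) := by
  ext x
  rw [refl_apply (by omega) (by omega)]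
  simp only [simpleReflection, if_neg hi.ne', Equiv.Perm.mul_apply, Equiv.swap_apply_def]
  split_ifs <;> omega

theorem simpleReflection_eq_refl (i : ℕ) :
    ∃ p q : ℤ, p ≠ 0 ∧ q ≠ 0 ∧ p < q ∧ |p| ≤ i + 1 ∧ |q| ≤ i + 1 ∧
      simpleReflection i = refl p q := by
  rcases Nat.eq_zero_or_pos i with rfl | hi
  · exact ⟨-1, 1, by simp, by simp, by simp, by simp, by simp, simpleReflection_zero⟩
  · exact ⟨i, i + 1, by omega, by omega, by omega, by grind, by grind, simpleReflection_pos hi⟩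

theorem simpleReflection_mul_self (i : ℕ) : simpleReflection i * simpleReflection i = 1 := by
  obtain ⟨p, q, hp, hq, -, -, -, h⟩ := simpleReflection_eq_refl i
  rw [h, refl_mul_self hp hq]

theorem simpleReflection_neg (i : ℕ) (x : ℤ) :
    simpleReflection i (-x) = -simpleReflection i x := by
  obtain ⟨p, q, hp, hq, -, -, -, h⟩ := simpleReflection_eq_refl i
  rw [h, refl_neg hp hq]

theorem simpleReflection_apply_ne_zero (i : ℕ) {x : ℤ} (hx : x ≠ 0) :
    simpleReflection i x ≠ 0 := by
  obtain ⟨p, q, hp, hq, -, -, -, h⟩ := simpleReflection_eq_refl i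
  rw [h, refl_apply hp hq]
  split_ifs <;> omega

/-- A simple reflection inverts only one pair up to sign. -/
theorem refl_eq_simpleReflection {i : ℕ} {p q : ℤ} (hp : p ≠ 0) (hq : q ≠ 0) (hpq : p < q)
    (h : simpleReflection i q < simpleReflection i p) : refl p q = simpleReflection i := by
  rcases Nat.eq_zero_or_pos i with rfl | hi
  · rw [simpleReflection_zero, refl_apply (by simp) (by simp),
      refl_apply (by simp) (by simp)] at h
    have : p = -1 ∧ q = 1 := by split_ifs at h <;> omega
    rw [this.1, this.2, simpleReflection_zero]
  · rw [simpleReflection_pos hi, refl_apply (by omega) (by omega),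
      refl_apply (by omega) (by omega)] at h
    have : p = i ∧ q = i + 1 ∨ p = -(i + 1) ∧ q = -i := by split_ifs at h <;> omega
    rcases this with ⟨rfl, rfl⟩ | ⟨rfl, rfl⟩
    · rw [simpleReflection_pos hi]
    · rw [refl_neg_neg (by omega) (by omega), refl_comm (by omega) (by omega),
        simpleReflection_pos hi]

theorem refl_mem_hyperoctahedral {n : ℕ} {p q : ℤ} (hp : p ≠ 0) (hq : q ≠ 0) (hpn : |p| ≤ n)
    (hqn : |q| ≤ n) : refl p q ∈ hyperoctahedral n := by
  refine ⟨refl_neg hp hq, fun i hi => ?_⟩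
  rw [refl_apply hp hq]
  split_ifs <;> grind

theorem simpleReflection_mem_hyperoctahedral {n i : ℕ} (hi : i < n) :
    simpleReflection i ∈ hyperoctahedral n := by
  obtain ⟨p, q, hp, hq, -, hpn, hqn, h⟩ := simpleReflection_eq_refl i
  rw [h]
  exact refl_mem_hyperoctahedral hp hq (by omega) (by omega)

/-! ### Words, strong exchange and deletion -/

theorem wordProd_cons (i : ℕ) (l : List ℕ) :
    wordProd (i :: l) = simpleReflection i * wordProd l := by
  simp [wordProd]

theorem wordProd_mem_hyperoctahedral {n : ℕ} {l : List ℕ} (h : ∀ i ∈ l, i < n) :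
    wordProd l ∈ hyperoctahedral n := by
  refine Subgroup.list_prod_mem _ fun x hx => ?_
  obtain ⟨i, hi, rfl⟩ := List.mem_map.1 hx
  exact simpleReflection_mem_hyperoctahedral (h i hi)

/-- The strong exchange property. -/
theorem exists_wordProd_eq_refl_mul (l : List ℕ) {p q : ℤ} (hp : p ≠ 0) (hq : q ≠ 0)
    (hpq : p < q) (h : (wordProd l)⁻¹ q < (wordProd l)⁻¹ p) :
    ∃ l' : List ℕ, l'.Sublist l ∧ l'.length + 1 = l.length ∧
      wordProd l' = refl p q * wordProd l := by
  induction l generalizing p q with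
  | nil => simp [wordProd] at h; omega
  | cons i l ih =>
    have hs : (simpleReflection i)⁻¹ = simpleReflection i :=
      inv_eq_of_mul_eq_one_left (simpleReflection_mul_self i)
    rw [wordProd_cons] at h ⊢
    rw [mul_inv_rev, hs, Equiv.Perm.mul_apply, Equiv.Perm.mul_apply] at h
    rcases lt_trichotomy (simpleReflection i p) (simpleReflection i q) with hlt | heq | hgt
    -- The first letter keeps the order of the pair: apply induction to the image pair and conjugate
    -- back past that letter.
    · obtain ⟨l', hl, hlen, hprod⟩ := ih (simpleReflection_apply_ne_zero i hp)
        (simpleReflection_apply_ne_zero i hq) hlt h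
      refine ⟨i :: l', hl.cons_cons i, by simp [hlen], ?_⟩
      rw [wordProd_cons, hprod, ← mul_assoc, mul_refl (simpleReflection_neg i), mul_assoc,
        ← Equiv.Perm.mul_apply, ← Equiv.Perm.mul_apply, simpleReflection_mul_self]
      rfl
    · exact absurd ((simpleReflection i).injective heq) hpq.ne
    -- The first letter inverts the pair, hence equals the reflection; it is the letter to delete.
    · refine ⟨l, List.sublist_cons_self i l, rfl, ?_⟩
      rw [refl_eq_simpleReflection hp hq hpq hgt, ← mul_assoc, simpleReflection_mul_self, one_mul]

/-- Deleting a letter from a word multiplies its product by a reflection. -/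
theorem wordProd_sublist_eq_refl_mul {l' l : List ℕ} (h : l'.Sublist l)
    (hlen : l'.length + 1 = l.length) :
    ∃ p q : ℤ, p ≠ 0 ∧ q ≠ 0 ∧ p ≠ q ∧ wordProd l' = refl p q * wordProd l := by
  induction h with
  | slnil => simp at hlen
  | @cons l₁ l₂ i h ih =>
    obtain rfl := h.eq_of_length (by simpa using hlen)
    obtain ⟨p, q, hp, hq, hpq, -, -, hi⟩ := simpleReflection_eq_refl i
    refine ⟨p, q, hp, hq, hpq.ne, ?_⟩
    rw [wordProd_cons, hi, ← mul_assoc, refl_mul_self hp hq, one_mul]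
  | cons_cons i h ih =>
    obtain ⟨p, q, hp, hq, hpq, hprod⟩ := ih (by simpa using hlen)
    refine ⟨_, _, simpleReflection_apply_ne_zero i hp, simpleReflection_apply_ne_zero i hq,
      (simpleReflection i).injective.ne hpq, ?_⟩
    rw [wordProd_cons, wordProd_cons, hprod, ← mul_assoc, mul_refl (simpleReflection_neg i),
      mul_assoc]

/-! ### Signed permutations and generation by simple reflections -/

theorem perm_inv_apply_self (w : Equiv.Perm ℤ) (x : ℤ) : w⁻¹ (w x) = x :=
  w.symm_apply_apply x

theorem perm_apply_inv_self (w : Equiv.Perm ℤ) (x : ℤ) : w (w⁻¹ x) = x :=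
  w.apply_symm_apply x

theorem hyperoctahedral_apply_zero {n : ℕ} {w : Equiv.Perm ℤ} (hw : w ∈ hyperoctahedral n) :
    w 0 = 0 := by
  have := hw.1 0
  simp at this
  omega

theorem hyperoctahedral_apply_ne_zero {n : ℕ} {w : Equiv.Perm ℤ} (hw : w ∈ hyperoctahedral n)
    {x : ℤ} (hx : x ≠ 0) : w x ≠ 0 := by
  rw [← hyperoctahedral_apply_zero hw]
  exact w.injective.ne hx

theorem hyperoctahedral_abs_le {n : ℕ} {w : Equiv.Perm ℤ} (hw : w ∈ hyperoctahedral n)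
    {x : ℤ} (hx : |x| ≤ n) : |w x| ≤ n := by
  by_contra! h
  have := w.injective (hw.2 _ h)
  rw [this] at h
  omega

/-- Every nonzero value can be moved to the largest one by a product of simple reflections. -/
theorem exists_wordProd_apply_eq {n : ℕ} (d : ℕ) {p : ℤ} (hp : p ≠ 0) (hpn : |p| ≤ n)
    (hd : (n : ℤ) - p ≤ d) : ∃ l : List ℕ, (∀ i ∈ l, i < n) ∧ wordProd l p = n := by
  induction d generalizing p with
  | zero => exact ⟨[], by simp, by simp [wordProd]; grind⟩
  | succ d ih =>
    -- Some simple reflection raises `p` to `p + 1`, or from `-1` to `1` across zero; `d` bounds the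
    -- remaining distance to `n`.
    have step : ∀ i : ℕ, i < n → simpleReflection i p ≠ 0 → |simpleReflection i p| ≤ n →
        p < simpleReflection i p → ∃ l : List ℕ, (∀ i ∈ l, i < n) ∧ wordProd l p = n := by
      intro i hi h0 hn hlt
      obtain ⟨l, hl, hl'⟩ := ih h0 hn (by omega)
      refine ⟨l ++ [i], by grind, ?_⟩
      simpa [wordProd] using hl'
    have hpn' := abs_le.1 hpn
    rcases lt_trichotomy p (-1) with h | rfl | h
    · have hs : simpleReflection (-p - 1).toNat p = p + 1 := by
        rw [simpleReflection_pos (by omega), refl_apply (by omega) (by omega)]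
        split_ifs <;> omega
      exact step (-p - 1).toNat (by omega) (by omega) (by rw [hs, abs_le]; omega) (by omega)
    · have hs : simpleReflection 0 (-1) = 1 := by simp [simpleReflection]
      exact step 0 (by omega) (by omega) (by rw [hs, abs_le]; omega) (by omega)
    · by_cases hpn2 : p = n
      · exact ⟨[], by simp, by simpa [wordProd] using hpn2⟩
      · have hs : simpleReflection p.toNat p = p + 1 := by
          rw [simpleReflection_pos (by omega), refl_apply (by omega) (by omega)]
          split_ifs <;> omega
        exact step p.toNat (by omega) (by omega) (by rw [hs, abs_le]; omega) (by omega)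

theorem wordProd_append (l₁ l₂ : List ℕ) :
    wordProd (l₁ ++ l₂) = wordProd l₁ * wordProd l₂ := by
  simp [wordProd]

theorem wordProd_reverse (l : List ℕ) : wordProd l.reverse = (wordProd l)⁻¹ := by
  induction l with
  | nil => simp [wordProd]
  | cons i l ih =>
    rw [List.reverse_cons, wordProd_append, ih, wordProd_cons i l, mul_inv_rev,
      inv_eq_of_mul_eq_one_left (simpleReflection_mul_self i)]
    simp [wordProd]

/-- The simple reflections generate the hyperoctahedral group. -/
theorem exists_isWord {n : ℕ} {w : Equiv.Perm ℤ} (hw : w ∈ hyperoctahedral n) :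
    ∃ l, IsWord n l w := by
  induction n generalizing w with
  | zero =>
    refine ⟨[], by simp, ?_⟩
    ext x
    rcases eq_or_ne x 0 with rfl | hx
    · rw [hyperoctahedral_apply_zero hw]; rfl
    · rw [hw.2 x (by simpa using hx)]; rfl
  | succ n ih =>
    -- Moving the value `w (n + 1)` to `n + 1` leaves an element of the smaller group. The distance
    -- is at most `2 * n + 2`, since values are at least `-(n + 1)`.
    obtain ⟨l, hl, hlw⟩ := exists_wordProd_apply_eq (n := n + 1) (2 * n + 2) (p := w (n + 1))
      (hyperoctahedral_apply_ne_zero hw (by omega))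
      (hyperoctahedral_abs_le hw (by rw [abs_le]; push_cast; omega)) (by
        have := abs_le.1 (hyperoctahedral_abs_le hw (x := n + 1) (by rw [abs_le]; push_cast; omega))
        push_cast at this ⊢
        omega)
    have hmem := mul_mem (wordProd_mem_hyperoctahedral hl) hw
    have hfix : (wordProd l * w) (n + 1) = n + 1 := by
      rw [Equiv.Perm.mul_apply, hlw]; push_cast; rfl
    obtain ⟨l', hl', hprod⟩ := ih (w := wordProd l * w) ⟨hmem.1, fun i hi => by
      rcases lt_or_eq_of_le (show (n : ℤ) + 1 ≤ |i| by omega) with h | h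
      · exact hmem.2 i (by push_cast; omega)
      · rcases eq_or_eq_neg_of_abs_eq h.symm with rfl | rfl
        · exact hfix
        · rw [hmem.1, hfix]⟩
    refine ⟨l.reverse ++ l', ?_, ?_⟩
    · grind
    · rw [wordProd_append, hprod, wordProd_reverse, inv_mul_cancel_left]

/-! ### Length under reflections -/

theorem exists_isReducedWord {n : ℕ} {w : Equiv.Perm ℤ} (hw : w ∈ hyperoctahedral n) :
    ∃ l, IsReducedWord n l w := by
  obtain ⟨l, hl⟩ := exists_isWord hw
  exact Nat.sInf_mem (s := {m | ∃ l : List ℕ, IsWord n l w ∧ l.length = m}) ⟨_, l, hl, rfl⟩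

theorem length_le_of_isWord {n : ℕ} {l : List ℕ} {w : Equiv.Perm ℤ} (h : IsWord n l w) :
    length n w ≤ l.length :=
  Nat.sInf_le ⟨l, h, rfl⟩

theorem exchange {n : ℕ} {w : Equiv.Perm ℤ} (hw : w ∈ hyperoctahedral n) {p q : ℤ} (hp : p ≠ 0)
    (hq : q ≠ 0) (hpq : p < q) (h : w⁻¹ q < w⁻¹ p) :
    BruhatLE n (refl p q * w) w ∧ length n (refl p q * w) < length n w := by
  obtain ⟨l, hl⟩ := exists_isReducedWord hw
  obtain ⟨l', hsub, hlen, hprod⟩ := exists_wordProd_eq_refl_mul l hp hq hpq (by rwa [hl.1.2])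
  rw [hl.1.2] at hprod
  refine ⟨⟨l, hl, l', hsub, hprod⟩, ?_⟩
  have := length_le_of_isWord (n := n) ⟨fun i hi => hl.1.1 i (hsub.subset hi), hprod⟩
  have := hl.2
  omega

/-- Left multiplication by a reflection lowers the length iff the pair it exchanges is inverted. -/
theorem length_refl_mul_lt_iff {n : ℕ} {w : Equiv.Perm ℤ} (hw : w ∈ hyperoctahedral n) {p q : ℤ}
    (hp : p ≠ 0) (hq : q ≠ 0) (hpn : |p| ≤ n) (hqn : |q| ≤ n) (hpq : p < q) :
    length n (refl p q * w) < length n w ↔ w⁻¹ q < w⁻¹ p := by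
  refine ⟨fun h => ?_, fun h => (exchange hw hp hq hpq h).2⟩
  by_contra hle
  have hne : w⁻¹ p ≠ w⁻¹ q := w⁻¹.injective.ne hpq.ne
  -- If `w` does not invert the pair, then `refl p q * w` does, and exchange there yields the
  -- opposite inequality.
  have hlt : (refl p q * w)⁻¹ q < (refl p q * w)⁻¹ p := by
    rw [mul_inv_rev, refl_inv hp hq, Equiv.Perm.mul_apply, Equiv.Perm.mul_apply,
      refl_apply hp hq, refl_apply hp hq, if_neg hpq.ne', if_pos rfl, if_pos rfl]
    omega
  have := (exchange (mul_mem (refl_mem_hyperoctahedral hp hq hpn hqn) hw) hp hq hpq hlt).2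
  rw [← mul_assoc, refl_mul_self hp hq, one_mul] at this
  omega

theorem length_lt_refl_mul_iff {n : ℕ} {w : Equiv.Perm ℤ} (hw : w ∈ hyperoctahedral n) {p q : ℤ}
    (hp : p ≠ 0) (hq : q ≠ 0) (hpn : |p| ≤ n) (hqn : |q| ≤ n) (hpq : p < q) :
    length n w < length n (refl p q * w) ↔ w⁻¹ p < w⁻¹ q := by
  have := length_refl_mul_lt_iff (mul_mem (refl_mem_hyperoctahedral hp hq hpn hqn) hw) hp hq
    hpn hqn hpq
  rw [← mul_assoc, refl_mul_self hp hq, one_mul, mul_inv_rev, refl_inv hp hq,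
    Equiv.Perm.mul_apply, Equiv.Perm.mul_apply,
      refl_apply hp hq, refl_apply hp hq, if_neg hpq.ne', if_pos rfl, if_pos rfl] at this
  exact this

theorem length_simpleReflection_mul_le {n : ℕ} {w : Equiv.Perm ℤ} (hw : w ∈ hyperoctahedral n)
    {i : ℕ} (hi : i < n) : length n (simpleReflection i * w) ≤ length n w + 1 := by
  obtain ⟨l, hl⟩ := exists_isReducedWord hw
  have := length_le_of_isWord (n := n) (l := i :: l) (w := simpleReflection i * w)
    ⟨by simpa using ⟨hi, hl.1.1⟩, by rw [wordProd_cons, hl.1.2]⟩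
  rwa [List.length_cons, hl.2] at this

theorem length_le_simpleReflection_mul {n : ℕ} {w : Equiv.Perm ℤ} (hw : w ∈ hyperoctahedral n)
    {i : ℕ} (hi : i < n) : length n w ≤ length n (simpleReflection i * w) + 1 := by
  have := length_simpleReflection_mul_le
    (mul_mem (simpleReflection_mem_hyperoctahedral hi) hw) hi
  rwa [← mul_assoc, simpleReflection_mul_self, one_mul] at this

/-- By `mul_refl`, the right factor becomes a left reflection in the values at the two positions.
For `i = 0` these values are `-w 1` and `w 1`, and `w 0 = 0` makes the criterion uniform. -/
theorem length_lt_mul_simpleReflection_iff {n : ℕ} {w : Equiv.Perm ℤ}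
    (hw : w ∈ hyperoctahedral n) {i : ℕ} (hi : i < n) :
    length n w < length n (w * simpleReflection i) ↔ w i < w (i + 1) := by
  rcases Nat.eq_zero_or_pos i with rfl | hpos
  · have h1 : |w 1| ≤ n := hyperoctahedral_abs_le hw (by simp; omega)
    have h0 : w 1 ≠ 0 := hyperoctahedral_apply_ne_zero hw (by simp)
    rw [simpleReflection_zero, mul_refl hw.1, hw.1]
    simp only [Nat.cast_zero, hyperoctahedral_apply_zero hw, zero_add]
    rcases lt_or_gt_of_ne h0 with h | h
    · rw [refl_comm (by omega) h0]
      have := length_lt_refl_mul_iff hw h0 (neg_ne_zero.2 h0) h1 (by simpa using h1) (by omega)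
      rw [this, ← hw.1, perm_inv_apply_self, perm_inv_apply_self]
      omega
    · have := length_lt_refl_mul_iff hw (neg_ne_zero.2 h0) h0 (by simpa using h1) h1 (by omega)
      rw [this, ← hw.1, perm_inv_apply_self, perm_inv_apply_self]
      omega
  · have h1 : |w i| ≤ n := hyperoctahedral_abs_le hw (by simp; omega)
    have h2 : |w (i + 1)| ≤ n := hyperoctahedral_abs_le hw (by rw [abs_le]; omega)
    have h01 : w i ≠ 0 := hyperoctahedral_apply_ne_zero hw (by omega)
    have h02 : w (i + 1) ≠ 0 := hyperoctahedral_apply_ne_zero hw (by omega)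
    have hne : w i ≠ w (i + 1) := w.injective.ne (by omega)
    rw [simpleReflection_pos hpos, mul_refl hw.1]
    rcases lt_or_gt_of_ne hne with h | h
    · rw [length_lt_refl_mul_iff hw h01 h02 h1 h2 h, perm_inv_apply_self,
        perm_inv_apply_self]
      omega
    · rw [refl_comm h01 h02, length_lt_refl_mul_iff hw h02 h01 h2 h1 h, perm_inv_apply_self,
        perm_inv_apply_self]
      omega

/-! ### Grassmannian elements as block-increasing permutations -/

theorem apply_lt_apply_of_succ {f : ℤ → ℤ} {s t : ℤ}
    (h : ∀ i, s ≤ i → i < t → f i < f (i + 1)) {i j : ℤ} (hi : s ≤ i) (hij : i < j)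
    (hj : j ≤ t) : f i < f j := by
  induction j, (show i + 1 ≤ j by omega) using Int.leInduction with
  | base => exact h i hi (by omega)
  | succ j hj' ih => exact (ih (by omega) (by omega)).trans (h j (by omega) (by omega))

/-- The `k`-Grassmannian elements are those increasing on `[0, k]` and on `(k, n]`. -/
theorem mem_grassmannian_iff {n k : ℕ} (hk : k ≤ n) {w : Equiv.Perm ℤ}
    (hw : w ∈ hyperoctahedral n) :
    w ∈ grassmannian n k ↔ (∀ i j : ℤ, 0 ≤ i → i < j → j ≤ k → w i < w j) ∧
      ∀ i j : ℤ, k < i → i < j → j ≤ n → w i < w j := by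
  constructor
  · rintro ⟨-, h⟩
    have key : ∀ i : ℤ, 0 ≤ i → i < n → i ≠ k → w i < w (i + 1) := fun i h0 hn hik => by
      have := (length_lt_mul_simpleReflection_iff hw (i := i.toNat) (by omega)).1
        (h i.toNat (by omega) (by omega))
      rwa [Int.toNat_of_nonneg h0] at this
    exact ⟨fun i j hi hij hj => apply_lt_apply_of_succ
        (fun i hi hj => key i hi (by omega) (by omega)) hi hij hj,
      fun i j hi hij hj => apply_lt_apply_of_succ (s := k + 1) (t := n)
        (fun i hi hj => key i (by omega) (by omega) (by omega)) (by omega) hij hj⟩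
  · rintro ⟨h1, h2⟩
    refine ⟨hw, fun i hi hik => (length_lt_mul_simpleReflection_iff hw hi).2 ?_⟩
    rcases lt_or_gt_of_ne hik with h | h
    · exact h1 _ _ (by omega) (by omega) (by omega)
    · exact h2 _ _ (by omega) (by omega) (by omega)

/-! ### A criterion for covers -/

/-- Induction on `a`: with `s = refl a (a + 1)`, one has `refl b a * s = s * refl b (a + 1)`, so the
bound for `s * w` transfers to `w` once `s` changes the lengths of `w` and `refl b (a + 1) * w` in
the same direction. Hypothesis `hc` at the intermediate value `a` ensures this. -/
theorem length_le_length_refl_mul {n : ℕ} {w : Equiv.Perm ℤ} (hw : w ∈ hyperoctahedral n)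
    {a b : ℤ} (hb : 0 < b) (hba : b < a) (han : a ≤ n)
    (hc : ∀ c, b < c → c < a → w⁻¹ c < w⁻¹ a ∨ w⁻¹ b < w⁻¹ c) (hab : w⁻¹ a < w⁻¹ b) :
    length n w ≤ length n (refl b a * w) + 1 := by
  induction a, (show b + 1 ≤ a by omega) using Int.leInduction generalizing w with
  | base =>
    have := length_le_simpleReflection_mul hw (i := b.toNat) (by omega)
    rwa [simpleReflection_pos (by omega), Int.toNat_of_nonneg hb.le] at this
  | succ a hba' ih =>
    have hs : simpleReflection a.toNat = refl a (a + 1) := by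
      rw [simpleReflection_pos (by omega), Int.toNat_of_nonneg (by omega)]
    have hsw := mul_mem (simpleReflection_mem_hyperoctahedral (n := n) (i := a.toNat) (by omega)) hw
    rw [hs] at hsw
    have hinv : ∀ x, (refl a (a + 1) * w)⁻¹ x = w⁻¹ (refl a (a + 1) x) := fun x => by
      rw [mul_inv_rev, refl_inv (by omega) (by omega), Equiv.Perm.mul_apply]
    have hra : refl a (a + 1) a = a + 1 := by
      rw [refl_apply (by omega) (by omega), if_pos rfl]
    have hrx : ∀ x, 0 < x → x < a → refl a (a + 1) x = x := fun x h0 h1 => by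
      rw [refl_apply (by omega) (by omega)]; split_ifs <;> omega
    have hIH := ih hsw (by omega) (by omega) (fun c h1 h2 => by
        rw [hinv, hinv, hinv, hra, hrx b (by omega) (by omega), hrx c (by omega) (by omega)]
        exact hc c h1 (by omega)) (by
        rw [hinv, hinv, hra, hrx b (by omega) (by omega)]
        exact hab)
    have hcomm : refl b a * (refl a (a + 1) * w) = refl a (a + 1) * (refl b (a + 1) * w) := by
      rw [← mul_assoc, ← mul_assoc, mul_refl (refl_neg (by omega) (by omega)) b (a + 1),
        hrx b hb (by omega), refl_apply (by omega) (by omega), if_neg (by omega), if_pos rfl]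
    have ht := mul_mem (refl_mem_hyperoctahedral (n := n) (p := b) (q := a + 1) (by omega)
      (by omega) (by rw [abs_le]; omega) (by rw [abs_le]; omega)) hw
    have htinv : ∀ x, (refl b (a + 1) * w)⁻¹ x = w⁻¹ (refl b (a + 1) x) := fun x => by
      rw [mul_inv_rev, refl_inv (by omega) (by omega), Equiv.Perm.mul_apply]
    have hta : refl b (a + 1) a = a := by
      rw [refl_apply (by omega) (by omega)]; split_ifs <;> omega
    have hta1 : refl b (a + 1) (a + 1) = b := by
      rw [refl_apply (by omega) (by omega), if_neg (by omega), if_pos rfl]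
    rw [hcomm] at hIH
    have hA : |a| ≤ n := by rw [abs_le]; omega
    have hA1 : |a + 1| ≤ n := by rw [abs_le]; omega
    have e1 := length_refl_mul_lt_iff hw (p := a) (q := a + 1) (by omega) (by omega) hA hA1
      (by omega)
    have e2 := length_lt_refl_mul_iff hw (p := a) (q := a + 1) (by omega) (by omega) hA hA1
      (by omega)
    have e3 := length_refl_mul_lt_iff ht (p := a) (q := a + 1) (by omega) (by omega) hA hA1
      (by omega)
    have e4 := length_lt_refl_mul_iff ht (p := a) (q := a + 1) (by omega) (by omega) hA hA1
      (by omega)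
    have l1 := length_simpleReflection_mul_le hw (i := a.toNat) (by omega)
    have l2 := length_le_simpleReflection_mul hw (i := a.toNat) (by omega)
    have l3 := length_simpleReflection_mul_le ht (i := a.toNat) (by omega)
    have l4 := length_le_simpleReflection_mul ht (i := a.toNat) (by omega)
    rw [hs] at l1 l2 l3 l4
    rw [htinv, htinv, hta, hta1] at e3 e4
    -- In the first case `s` lengthens both elements, in the second it shortens both.
    rcases hc a (by omega) (by omega) with h | h
    · have := e2.2 h
      have := e4.2 (by omega)
      omega
    · have := e1.2 (by omega)
      have := e3.2 (by omega)
      omega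

theorem covers_refl_mul {n : ℕ} {w : Equiv.Perm ℤ} (hw : w ∈ hyperoctahedral n) {a b : ℤ}
    (hb : 0 < b) (hba : b < a) (han : a ≤ n)
    (hc : ∀ c, b < c → c < a → w⁻¹ c < w⁻¹ a ∨ w⁻¹ b < w⁻¹ c) (hab : w⁻¹ a < w⁻¹ b) :
    Covers n w (refl b a * w) := by
  obtain ⟨hle, hlt⟩ := exchange hw hb.ne' (by omega) hba hab
  have := length_le_length_refl_mul hw hb hba han hc hab
  exact ⟨hle, by omega⟩

/-! ### The four patterns give covers -/

theorem hasOneLine_replaceTwo {n : ℕ} {r w : Equiv.Perm ℤ} (hr : r * w ∈ hyperoctahedral n)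
    {i j x y : ℤ} (hij : i ≠ j) (hi : r (w i) = x) (hj : r (w j) = y)
    (h : ∀ m, 1 ≤ m → m ≠ i → m ≠ j → r (w m) = w m) :
    HasOneLine n (r * w) (replaceTwo w i x j y) := by
  refine ⟨hr, fun m hm => ?_⟩
  unfold replaceTwo
  rw [Equiv.Perm.mul_apply]
  rcases eq_or_ne m j with rfl | hmj
  · rw [Function.update_self, hj]
  rw [Function.update_of_ne hmj]
  rcases eq_or_ne m i with rfl | hmi
  · rw [Function.update_self, hi]
  rw [Function.update_of_ne hmi, h m hm.1 hmi hmj]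

section

variable {n k : ℕ} {w : Equiv.Perm ℤ} {i j a b : ℤ}

theorem hyperoctahedral_apply_eq_iff (hw : w ∈ hyperoctahedral n) {x m y : ℤ} (h : w x = y) :
    (w m = y ↔ m = x) ∧ (w m = -y ↔ m = -x) := by
  rw [← h, ← hw.1, w.apply_eq_iff_eq, w.apply_eq_iff_eq]
  simp

theorem hyperoctahedral_inv_apply (hw : w ∈ hyperoctahedral n) {x y : ℤ} (h : w x = y) :
    w⁻¹ y = x ∧ w⁻¹ (-y) = -x := by
  rw [← h, ← hw.1, perm_inv_apply_self, perm_inv_apply_self]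
  simp

theorem Pattern1.hasOneLine (hw : w ∈ hyperoctahedral n) (h : Pattern1 n k w i) :
    HasOneLine n (refl (-1) 1 * w) (replaceOne w i 1) := by
  obtain ⟨⟨hi, hin⟩, hwi⟩ := h
  refine ⟨mul_mem (refl_mem_hyperoctahedral (by simp) (by simp) (by simp; omega)
    (by simp; omega)) hw, fun m hm => ?_⟩
  unfold replaceOne
  rw [Equiv.Perm.mul_apply, refl_apply (by simp) (by simp)]
  obtain ⟨h1, h2⟩ := hyperoctahedral_apply_eq_iff hw (m := m) hwi
  have := hm.1
  rcases eq_or_ne m i with rfl | hmi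
  · simp [hwi]
  · rw [Function.update_of_ne hmi]
    split_ifs <;> omega

theorem Pattern2.bounds (hw : w ∈ hyperoctahedral n) (h : Pattern2 n k w i j a) :
    2 ≤ a ∧ a ≤ n ∧ k < i ∧ i ≤ n ∧ k < j ∧ j ≤ n ∧ w i = -a ∧ w j = a - 1 ∧ i ≠ j := by
  obtain ⟨⟨hi, hin⟩, ⟨hj, hjn⟩, ha, hwi, hwj⟩ := h
  have := abs_le.1 (hyperoctahedral_abs_le hw (x := i) (by rw [abs_le]; omega))
  have : i ≠ j := by rintro rfl; omega
  omega

theorem Pattern2.hasOneLine (hw : w ∈ hyperoctahedral n) (h : Pattern2 n k w i j a) :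
    HasOneLine n (refl (a - 1) a * w) (replaceTwo w i (-(a - 1)) j a) := by
  obtain ⟨ha, han, hi, hin, hj, hjn, hwi, hwj, hij⟩ := h.bounds hw
  refine hasOneLine_replaceTwo (mul_mem (refl_mem_hyperoctahedral (by omega) (by omega)
    (by rw [abs_le]; omega) (by rw [abs_le]; omega)) hw) hij ?_ ?_ fun m hm hmi hmj => ?_
  · rw [refl_apply (by omega) (by omega)]; split_ifs <;> omega
  · rw [refl_apply (by omega) (by omega)]; split_ifs <;> omega
  · obtain ⟨h1, h2⟩ := hyperoctahedral_apply_eq_iff hw (m := m) hwi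
    obtain ⟨h3, h4⟩ := hyperoctahedral_apply_eq_iff hw (m := m) hwj
    rw [refl_apply (by omega) (by omega)]; split_ifs <;> omega

theorem Pattern3.bounds (hw : w ∈ hyperoctahedral n) (hk : k ≤ n) (h : Pattern3 n k w i j a b) :
    0 < b ∧ b < a ∧ a ≤ n ∧ 1 ≤ i ∧ i ≤ k ∧ k < j ∧ j ≤ n ∧ w i = a ∧ w j = b ∧
      ∀ c, b < c → c < a → ∃ m : ℤ, k < m ∧ m ≤ n ∧ w m = -c := by
  obtain ⟨⟨hi, hin⟩, ⟨hj, hjn⟩, hb, hba, hwi, hwj, hc⟩ := h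
  have := abs_le.1 (hyperoctahedral_abs_le hw (x := i) (by rw [abs_le]; omega))
  refine ⟨hb, hba, by omega, hi, hin, hj, hjn, hwi, hwj, fun c h1 h2 => ?_⟩
  obtain ⟨-, m, hm, hwm⟩ := hc c ⟨h1, h2⟩
  exact ⟨m, hm.1, hm.2, hwm⟩

theorem Pattern3.hasOneLine (hw : w ∈ hyperoctahedral n) (hk : k ≤ n)
    (h : Pattern3 n k w i j a b) :
    HasOneLine n (refl b a * w) (replaceTwo w i b j a) := by
  obtain ⟨hb, hba, han, hi, hin, hj, hjn, hwi, hwj, -⟩ := h.bounds hw hk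
  refine hasOneLine_replaceTwo (mul_mem (refl_mem_hyperoctahedral (by omega) (by omega)
    (by rw [abs_le]; omega) (by rw [abs_le]; omega)) hw) (by omega) ?_ ?_ fun m hm hmi hmj => ?_
  · rw [refl_apply (by omega) (by omega)]; split_ifs <;> omega
  · rw [refl_apply (by omega) (by omega)]; split_ifs <;> omega
  · obtain ⟨h1, h2⟩ := hyperoctahedral_apply_eq_iff hw (m := m) hwi
    obtain ⟨h3, h4⟩ := hyperoctahedral_apply_eq_iff hw (m := m) hwj
    rw [refl_apply (by omega) (by omega)]; split_ifs <;> omega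

theorem Pattern4.bounds (hw : w ∈ hyperoctahedral n) (h : Pattern4 n k w i j a b) :
    0 < b ∧ b < a ∧ a ≤ n ∧ 1 ≤ i ∧ i ≤ k ∧ k < j ∧ j ≤ n ∧ w i = b ∧ w j = -a ∧
      ∀ c, b < c → c < a → ∃ m : ℤ, k < m ∧ m ≤ n ∧ w m = c := by
  obtain ⟨⟨hi, hin⟩, ⟨hj, hjn⟩, hb, hba, hwi, hwj, hc⟩ := h
  have := abs_le.1 (hyperoctahedral_abs_le hw (x := j) (by rw [abs_le]; omega))
  refine ⟨hb, hba, by omega, hi, hin, hj, hjn, hwi, hwj, fun c h1 h2 => ?_⟩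
  obtain ⟨-, m, hm, hwm⟩ := hc c ⟨h1, h2⟩
  exact ⟨m, hm.1, hm.2, hwm⟩

theorem Pattern4.hasOneLine (hw : w ∈ hyperoctahedral n) (h : Pattern4 n k w i j a b) :
    HasOneLine n (refl b a * w) (replaceTwo w i a j (-b)) := by
  obtain ⟨hb, hba, han, hi, hin, hj, hjn, hwi, hwj, -⟩ := h.bounds hw
  refine hasOneLine_replaceTwo (mul_mem (refl_mem_hyperoctahedral (by omega) (by omega)
    (by rw [abs_le]; omega) (by rw [abs_le]; omega)) hw) (by omega) ?_ ?_ fun m hm hmi hmj => ?_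
  · rw [refl_apply (by omega) (by omega)]; split_ifs <;> omega
  · rw [refl_apply (by omega) (by omega)]; split_ifs <;> omega
  · obtain ⟨h1, h2⟩ := hyperoctahedral_apply_eq_iff hw (m := m) hwi
    obtain ⟨h3, h4⟩ := hyperoctahedral_apply_eq_iff hw (m := m) hwj
    rw [refl_apply (by omega) (by omega)]; split_ifs <;> omega

/-- It suffices that the reflection keeps the order of any two values in the same block. -/
theorem refl_mul_mem_grassmannian (hk : k ≤ n) (hw : w ∈ hyperoctahedral n) {p q : ℤ}
    (hr : refl p q * w ∈ hyperoctahedral n)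
    (h : ∀ s t : ℤ, s < t → (0 ≤ s ∧ t ≤ k ∨ k < s ∧ t ≤ n) → w s < w t →
      refl p q (w s) < refl p q (w t)) (hg : w ∈ grassmannian n k) :
    refl p q * w ∈ grassmannian n k := by
  obtain ⟨h1, h2⟩ := (mem_grassmannian_iff hk hw).1 hg
  exact (mem_grassmannian_iff hk hr).2
    ⟨fun s t hs hst ht => h s t hst (.inl ⟨hs, ht⟩) (h1 s t hs hst ht),
      fun s t hs hst ht => h s t hst (.inr ⟨hs, ht⟩) (h2 s t hs hst ht)⟩

theorem Pattern1.covers (hk : k ≤ n) (hw : w ∈ grassmannian n k) (h : Pattern1 n k w i) :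
    refl (-1) 1 * w ∈ grassmannian n k ∧ Covers n w (refl (-1) 1 * w) := by
  have hone := (h.hasOneLine hw.1).1
  obtain ⟨⟨hi, hin⟩, hwi⟩ := h
  constructor
  · refine refl_mul_mem_grassmannian hk hw.1 hone (fun s t hst hb hlt => ?_) hw
    obtain ⟨h1, h2⟩ := hyperoctahedral_apply_eq_iff hw.1 (m := s) hwi
    obtain ⟨h3, h4⟩ := hyperoctahedral_apply_eq_iff hw.1 (m := t) hwi
    -- Raising `-1` to `1` could only upset comparisons with `0` and `1`, which sit at positions `0`
    -- and `-i`, outside `(k, n]`.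
    obtain ⟨h5, -⟩ := hyperoctahedral_apply_eq_iff hw.1 (m := t) (hyperoctahedral_apply_zero hw.1)
    rw [refl_apply (by omega) (by omega), refl_apply (by omega) (by omega)]
    split_ifs <;> omega
  · obtain ⟨h1, h2⟩ := hyperoctahedral_inv_apply hw.1 hwi
    obtain ⟨hle, hlt⟩ := exchange hw.1 (p := -1) (q := 1) (by omega) (by omega) (by omega)
      (by rw [neg_neg] at h2; omega)
    have := length_le_simpleReflection_mul hw.1 (i := 0) (by omega)
    rw [simpleReflection_zero] at this
    exact ⟨hle, by omega⟩

theorem Pattern2.covers (hk : k ≤ n) (hw : w ∈ grassmannian n k) (h : Pattern2 n k w i j a) :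
    refl (a - 1) a * w ∈ grassmannian n k ∧ Covers n w (refl (a - 1) a * w) := by
  have hone := (h.hasOneLine hw.1).1
  obtain ⟨ha, han, hi, hin, hj, hjn, hwi, hwj, hij⟩ := h.bounds hw.1
  constructor
  · refine refl_mul_mem_grassmannian hk hw.1 hone (fun s t hst hb hlt => ?_) hw
    obtain ⟨h1, h2⟩ := hyperoctahedral_apply_eq_iff hw.1 (m := s) hwi
    obtain ⟨h3, h4⟩ := hyperoctahedral_apply_eq_iff hw.1 (m := t) hwi
    obtain ⟨h5, h6⟩ := hyperoctahedral_apply_eq_iff hw.1 (m := s) hwj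
    obtain ⟨h7, h8⟩ := hyperoctahedral_apply_eq_iff hw.1 (m := t) hwj
    rw [refl_apply (by omega) (by omega), refl_apply (by omega) (by omega)]
    split_ifs <;> omega
  · obtain ⟨h1, h2⟩ := hyperoctahedral_inv_apply hw.1 hwi
    obtain ⟨h3, h4⟩ := hyperoctahedral_inv_apply hw.1 hwj
    rw [neg_neg] at h2
    exact covers_refl_mul hw.1 (by omega) (by omega) han (fun c _ _ => by omega) (by omega)

theorem Pattern3.covers (hk : k ≤ n) (hw : w ∈ grassmannian n k) (h : Pattern3 n k w i j a b) :
    refl b a * w ∈ grassmannian n k ∧ Covers n w (refl b a * w) := by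
  have hone := (h.hasOneLine hw.1 hk).1
  obtain ⟨hb, hba, han, hi, hin, hj, hjn, hwi, hwj, hc⟩ := h.bounds hw.1 hk
  constructor
  · refine refl_mul_mem_grassmannian hk hw.1 hone (fun s t hst hb hlt => ?_) hw
    obtain ⟨h1, h2⟩ := hyperoctahedral_apply_eq_iff hw.1 (m := s) hwi
    obtain ⟨h3, h4⟩ := hyperoctahedral_apply_eq_iff hw.1 (m := t) hwi
    obtain ⟨h5, h6⟩ := hyperoctahedral_apply_eq_iff hw.1 (m := s) hwj
    obtain ⟨h7, h8⟩ := hyperoctahedral_apply_eq_iff hw.1 (m := t) hwj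
    -- The values strictly between `b` and `a` all sit at negative positions, so the exchange upsets
    -- no order inside a block.
    have key : ∀ x, 0 ≤ x → ¬(b < w x ∧ w x < a) := by
      rintro x hx ⟨hx1, hx2⟩
      obtain ⟨m, hm, -, hwm⟩ := hc _ hx1 hx2
      have := (hyperoctahedral_apply_eq_iff hw.1 (m := x) hwm).2
      omega
    have := key s
    have := key t
    rw [refl_apply (by omega) (by omega), refl_apply (by omega) (by omega)]
    split_ifs <;> omega
  · obtain ⟨h1, h2⟩ := hyperoctahedral_inv_apply hw.1 hwi
    obtain ⟨h3, h4⟩ := hyperoctahedral_inv_apply hw.1 hwj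
    refine covers_refl_mul hw.1 hb hba han (fun c hbc hca => ?_) (by omega)
    obtain ⟨m, hm, -, hwm⟩ := hc c hbc hca
    have := (hyperoctahedral_inv_apply hw.1 hwm).2
    rw [neg_neg] at this
    omega

theorem Pattern4.covers (hk : k ≤ n) (hw : w ∈ grassmannian n k) (h : Pattern4 n k w i j a b) :
    refl b a * w ∈ grassmannian n k ∧ Covers n w (refl b a * w) := by
  have hone := (h.hasOneLine hw.1).1
  obtain ⟨hb, hba, han, hi, hin, hj, hjn, hwi, hwj, hc⟩ := h.bounds hw.1
  constructor
  · refine refl_mul_mem_grassmannian hk hw.1 hone (fun s t hst hb hlt => ?_) hw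
    obtain ⟨h1, h2⟩ := hyperoctahedral_apply_eq_iff hw.1 (m := s) hwi
    obtain ⟨h3, h4⟩ := hyperoctahedral_apply_eq_iff hw.1 (m := t) hwi
    obtain ⟨h5, h6⟩ := hyperoctahedral_apply_eq_iff hw.1 (m := s) hwj
    obtain ⟨h7, h8⟩ := hyperoctahedral_apply_eq_iff hw.1 (m := t) hwj
    -- The first block meets the exchange in `b`, the second in `-a`; neither contains a value that
    -- the moved entry would jump over.
    have key : ∀ x : ℤ, (0 ≤ x ∧ x ≤ k → ¬(b < w x ∧ w x < a)) ∧
        (0 ≤ x → ¬(b < -w x ∧ -w x < a)) := by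
      refine fun x => ⟨?_, ?_⟩
      · rintro hx ⟨hx1, hx2⟩
        obtain ⟨m, hm, -, hwm⟩ := hc _ hx1 hx2
        have := (hyperoctahedral_apply_eq_iff hw.1 (m := x) hwm).1
        omega
      · rintro hx ⟨hx1, hx2⟩
        obtain ⟨m, hm, -, hwm⟩ := hc _ hx1 hx2
        have := (hyperoctahedral_apply_eq_iff hw.1 (m := x) hwm).2
        omega
    have := key s
    have := key t
    rw [refl_apply (by omega) (by omega), refl_apply (by omega) (by omega)]
    split_ifs <;> omega
  · obtain ⟨h1, h2⟩ := hyperoctahedral_inv_apply hw.1 hwi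
    obtain ⟨h3, h4⟩ := hyperoctahedral_inv_apply hw.1 hwj
    rw [neg_neg] at h4
    refine covers_refl_mul hw.1 hb hba han (fun c hbc hca => ?_) (by omega)
    obtain ⟨m, hm, -, hwm⟩ := hc c hbc hca
    have := (hyperoctahedral_inv_apply hw.1 hwm).1
    omega

end

/-! ### The converse -/

/-- A reflection is normalized to one of the three families of positive roots. -/
theorem refl_normal_form {n : ℕ} {p q : ℤ} (hp : p ≠ 0) (hq : q ≠ 0) (hpq : p ≠ q)
    (hn : refl p q ∈ hyperoctahedral n) :
    (∃ a : ℤ, 0 < a ∧ a ≤ n ∧ refl p q = refl (-a) a) ∨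
    (∃ a b : ℤ, 0 < b ∧ b < a ∧ a ≤ n ∧ refl p q = refl b a) ∨
    ∃ a b : ℤ, 0 < b ∧ b < a ∧ a ≤ n ∧ refl p q = refl (-b) a := by
  have hpn : |p| ≤ n := by
    by_contra! h
    have := hn.2 p h
    rw [refl_apply hp hq, if_pos rfl] at this
    omega
  have hqn : |q| ≤ n := by
    by_contra! h
    have := hn.2 q h
    rw [refl_comm hp hq, refl_apply hq hp, if_pos rfl] at this
    omega
  rw [abs_le] at hpn hqn
  have c1 := refl_comm hp hq
  have c2 := refl_neg_neg hp hq
  have c3 := refl_comm (neg_ne_zero.2 hp) (neg_ne_zero.2 hq)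
  rcases eq_or_ne p (-q) with rfl | hne
  · rcases lt_or_gt_of_ne hq with h | h
    · exact .inl ⟨-q, by omega, by omega, c2.symm⟩
    · exact .inl ⟨q, by omega, by omega, rfl⟩
  · right
    rcases lt_or_gt_of_ne hp with h1 | h1 <;> rcases lt_or_gt_of_ne hq with h2 | h2
    · left
      rcases lt_or_gt_of_ne hpq with h | h
      · exact ⟨-p, -q, by omega, by omega, by omega, by rw [← c3, c2]⟩
      · exact ⟨-q, -p, by omega, by omega, by omega, c2.symm⟩
    · right
      rcases lt_or_gt_of_ne hne with h | h
      · exact ⟨-p, q, by omega, by omega, by omega, by rw [← c3, c2]⟩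
      · exact ⟨q, -p, by omega, by omega, by omega, by rw [neg_neg]⟩
    · right
      rcases lt_or_gt_of_ne hne with h | h
      · exact ⟨-q, p, by omega, by omega, by omega, c2.symm⟩
      · exact ⟨p, -q, by omega, by omega, by omega, by rw [neg_neg, c1]⟩
    · left
      rcases lt_or_gt_of_ne hpq with h | h
      · exact ⟨q, p, by omega, by omega, by omega, rfl⟩
      · exact ⟨p, q, by omega, by omega, by omega, c1⟩

section

variable {n k : ℕ} {w : Equiv.Perm ℤ}

theorem inv_lt_inv_of_mem_grassmannian (hk : k ≤ n) (hw : w ∈ grassmannian n k) {x y : ℤ}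
    (hxy : x < y) (h : 0 ≤ w⁻¹ x ∧ w⁻¹ x ≤ k ∧ 0 ≤ w⁻¹ y ∧ w⁻¹ y ≤ k ∨
      k < w⁻¹ x ∧ w⁻¹ x ≤ n ∧ k < w⁻¹ y ∧ w⁻¹ y ≤ n) : w⁻¹ x < w⁻¹ y := by
  obtain ⟨h1, h2⟩ := (mem_grassmannian_iff hk hw.1).1 hw
  by_contra! hle
  rcases lt_or_eq_of_le hle with hlt | heq
  · have : w (w⁻¹ y) < w (w⁻¹ x) := by
      rcases h with h | h
      · exact h1 _ _ h.2.2.1 hlt h.2.1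
      · exact h2 _ _ h.2.2.1 hlt h.2.1
    rw [perm_apply_inv_self, perm_apply_inv_self] at this
    omega
  · exact hxy.ne' (w⁻¹.injective heq)

/-- A positive value is at a position in `[1, k]`, in `(k, n]` or in `[-n, -k)`. -/
theorem inv_apply_of_mem_grassmannian (hk : k ≤ n) (hw : w ∈ grassmannian n k) {x : ℤ}
    (hx : 0 < x) (hxn : x ≤ n) :
    w⁻¹ (-x) = -w⁻¹ x ∧ -n ≤ w⁻¹ x ∧ w⁻¹ x ≤ n ∧ (0 < w⁻¹ x ∨ w⁻¹ x < -k) := by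
  have hinv := inv_mem hw.1
  have h0 := hyperoctahedral_apply_zero hinv
  have h1 := hinv.1 x
  have h2 := hyperoctahedral_apply_ne_zero hinv hx.ne'
  have h3 := abs_le.1 (hyperoctahedral_abs_le hinv (x := x) (by rw [abs_le]; omega))
  -- If `x` were at a position in `[-k, -1]`, then `-x < 0` would be in the first block to the right
  -- of the value `0`.
  have h4 := inv_lt_inv_of_mem_grassmannian hk hw (x := -x) (y := 0) (by omega)
  omega

theorem refl_mul_inv_apply {p q : ℤ} (hp : p ≠ 0) (hq : q ≠ 0) (x : ℤ) :
    (refl p q * w)⁻¹ x = w⁻¹ (refl p q x) := by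
  rw [mul_inv_rev, refl_inv hp hq, Equiv.Perm.mul_apply]

/-- If the reflection `refl p q` is the conjugate of `refl p' q'` by `refl c d`, and each of the
three factors inverts a pair, then it lowers the length by at least three. -/
theorem length_refl_conj_mul_add_three_le (hw : w ∈ hyperoctahedral n) {c d p q : ℤ}
    (hc : c ≠ 0) (hd : d ≠ 0) (hp : p ≠ 0) (hq : q ≠ 0) (hcn : |c| ≤ n) (hdn : |d| ≤ n)
    (hpn : |p| ≤ n) (hqn : |q| ≤ n) (hcd : c < d) (hpq : p < q) (h₁ : w⁻¹ d < w⁻¹ c)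
    (h₂ : w⁻¹ (refl c d q) < w⁻¹ (refl c d p))
    (h₃ : w⁻¹ (refl c d (refl p q d)) < w⁻¹ (refl c d (refl p q c))) :
    length n (refl (refl c d p) (refl c d q) * w) + 3 ≤ length n w := by
  have hm₁ := mul_mem (refl_mem_hyperoctahedral hc hd hcn hdn) hw
  have hm₂ := mul_mem (refl_mem_hyperoctahedral hp hq hpn hqn) hm₁
  have e₁ := (exchange hw hc hd hcd h₁).2
  have e₂ := (exchange hm₁ hp hq hpq
    (by rwa [refl_mul_inv_apply hc hd, refl_mul_inv_apply hc hd])).2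
  have e₃ := (exchange hm₂ hc hd hcd (by
    rwa [refl_mul_inv_apply hp hq, refl_mul_inv_apply hp hq, refl_mul_inv_apply hc hd,
      refl_mul_inv_apply hc hd])).2
  have : refl c d * (refl p q * (refl c d * w)) = refl (refl c d p) (refl c d q) * w := by
    rw [← mul_assoc, mul_refl (refl_neg hc hd), mul_assoc, ← mul_assoc (refl c d),
      refl_mul_self hc hd, one_mul]
  rw [this] at e₃
  omega

/-- The subword has length at least `length n w'`, one less than that of the reduced word; equal
lengths would give `w' = w`. So exactly one letter is deleted. -/
theorem Covers.exists_refl {w' : Equiv.Perm ℤ} (h : Covers n w w') :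
    ∃ p q : ℤ, p ≠ 0 ∧ q ≠ 0 ∧ p ≠ q ∧ w' = refl p q * w := by
  obtain ⟨⟨l, hl, l', hsub, rfl⟩, hlen⟩ := h
  have h1 := length_le_of_isWord (n := n) (l := l') (w := wordProd l')
    ⟨fun i hi => hl.1.1 i (hsub.subset hi), rfl⟩
  have h2 := hsub.length_le
  have h3 := hl.2
  have h4 : l'.length ≠ l.length := fun h => by
    rw [hsub.eq_of_length h, hl.1.2] at hlen
    omega
  obtain ⟨p, q, hp, hq, hpq, hprod⟩ := wordProd_sublist_eq_refl_mul hsub (by omega)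
  exact ⟨p, q, hp, hq, hpq, by rw [hprod, hl.1.2]⟩

theorem exists_pattern1_of_covers (hk : k ≤ n) (hw : w ∈ grassmannian n k) {a : ℤ} (ha : 0 < a)
    (han : a ≤ n) (hw' : refl (-a) a * w ∈ grassmannian n k)
    (hcov : length n w = length n (refl (-a) a * w) + 1) :
    a = 1 ∧ Pattern1 n k w (-w⁻¹ a) := by
  have hA : |a| ≤ n := by rw [abs_le]; omega
  have hinv := refl_mul_inv_apply (w := w) (p := -a) (q := a) (by omega) (by omega)
  have pa := inv_apply_of_mem_grassmannian hk hw ha han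
  have hlt := (length_refl_mul_lt_iff hw.1 (p := -a) (q := a) (by omega) (by omega)
    (by rwa [abs_neg]) hA (by omega)).1 (by omega)
  have hwa : w (-w⁻¹ a) = -a := by rw [hw.1.1, perm_apply_inv_self]
  have ha1 : a = 1 := by
    by_contra hne
    have pc := inv_apply_of_mem_grassmannian hk hw (x := a - 1) (by omega) (by omega)
    have ra : refl (-a) a a = -a := by
      rw [refl_apply (by omega) (by omega)]; split_ifs <;> omega
    have rc : refl (-a) a (a - 1) = a - 1 := by
      rw [refl_apply (by omega) (by omega)]; split_ifs <;> omega
    have rc' : refl (-a) a (-(a - 1)) = -(a - 1) := by rw [refl_neg (by omega) (by omega), rc]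
    have g1 := inv_lt_inv_of_mem_grassmannian hk hw (x := -a) (y := a - 1) (by omega)
    have g2 := inv_lt_inv_of_mem_grassmannian hk hw (x := -a) (y := -(a - 1)) (by omega)
    have g3 := inv_lt_inv_of_mem_grassmannian hk hw' (x := a - 1) (y := a) (by omega)
    have g4 := inv_lt_inv_of_mem_grassmannian hk hw' (x := -(a - 1)) (y := a) (by omega)
    rw [hinv, hinv, ra, rc] at g3
    rw [hinv, hinv, ra, rc'] at g4
    -- If `a - 1` were a `λ` or a `v`, then `w` and `w'` would order it oppositely against the entry
    -- changing from `-a` to `a`. So it is a `u`, and conjugation by `refl (a - 1) a` gives a drop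
    -- of three.
    have hu : 0 < w⁻¹ (a - 1) ∧ w⁻¹ (a - 1) ≤ k := by omega
    clear g1 g2 g3 g4
    have r1 : refl (a - 1) a a = a - 1 := by
      rw [refl_apply (by omega) (by omega)]; split_ifs <;> omega
    have r2 : refl (a - 1) a (a - 1) = a := by
      rw [refl_apply (by omega) (by omega)]; split_ifs <;> omega
    have r3 : refl (-(a - 1)) (a - 1) (a - 1) = -(a - 1) := by
      rw [refl_apply (by omega) (by omega)]; split_ifs <;> omega
    have r4 : refl (-(a - 1)) (a - 1) a = a := by
      rw [refl_apply (by omega) (by omega)]; split_ifs <;> omega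
    have hn := refl_neg (p := a - 1) (q := a) (by omega) (by omega)
    have := length_refl_conj_mul_add_three_le hw.1 (c := a - 1) (d := a) (p := -(a - 1))
      (q := a - 1) (by omega) (by omega) (by omega) (by omega) (by rw [abs_le]; omega) hA
      (by rw [abs_le]; omega) (by rw [abs_le]; omega) (by omega) (by omega) (by omega)
      (by rw [hn, r2]; omega) (by rw [r3, r4, hn, r1, r2]; omega)
    rw [hn, r2] at this
    omega
  exact ⟨ha1, ⟨by omega, by omega⟩, by rw [hwa, ha1]⟩

theorem exists_pattern_of_covers (hk : k ≤ n) (hw : w ∈ grassmannian n k) {a b : ℤ} (hb : 0 < b)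
    (hba : b < a) (han : a ≤ n) (hw' : refl b a * w ∈ grassmannian n k)
    (hcov : length n w = length n (refl b a * w) + 1) :
    (b = a - 1 ∧ Pattern2 n k w (-w⁻¹ a) (w⁻¹ b) a) ∨ Pattern3 n k w (w⁻¹ a) (w⁻¹ b) a b ∨
      Pattern4 n k w (w⁻¹ b) (-w⁻¹ a) a b := by
  have hA : |a| ≤ n := by rw [abs_le]; omega
  have hB : |b| ≤ n := by rw [abs_le]; omega
  have hinv := refl_mul_inv_apply (w := w) (p := b) (q := a) (by omega) (by omega)
  have pa := inv_apply_of_mem_grassmannian hk hw (by omega) han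
  have pb := inv_apply_of_mem_grassmannian hk hw hb (by omega)
  have hlt := (length_refl_mul_lt_iff hw.1 (p := b) (q := a) (by omega) (by omega)
    hB hA hba).1 (by omega)
  have hwa : w (-w⁻¹ a) = -a := by rw [hw.1.1, perm_apply_inv_self]
  have rn := refl_neg (p := b) (q := a) (by omega) (by omega)
  have ra : refl b a a = b := by
    rw [refl_apply (by omega) (by omega)]; split_ifs <;> omega
  have rb : refl b a b = a := by
    rw [refl_apply (by omega) (by omega)]; split_ifs <;> omega
  have rc : ∀ c, b < c → c < a → refl b a c = c := fun c h1 h2 => by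
    rw [refl_apply (by omega) (by omega)]; split_ifs <;> omega
  have g1 := inv_lt_inv_of_mem_grassmannian hk hw (x := b) (y := a) (by omega)
  have g2 := inv_lt_inv_of_mem_grassmannian hk hw (x := -a) (y := -b) (by omega)
  rcases lt_or_ge 0 (w⁻¹ a) with hapos | haneg
  · have hak : w⁻¹ a ≤ k ∧ k < w⁻¹ b := by omega
    clear g1 g2
    refine .inr (.inl ⟨⟨by omega, by omega⟩, ⟨by omega, by omega⟩, hb, hba,
      perm_apply_inv_self _ _, perm_apply_inv_self _ _, fun c ⟨h1, h2⟩ => ?_⟩)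
    have pc := inv_apply_of_mem_grassmannian hk hw (x := c) (by omega) (by omega)
    have g3 := inv_lt_inv_of_mem_grassmannian hk hw h1
    have g4 := inv_lt_inv_of_mem_grassmannian hk hw h2
    have g5 := inv_lt_inv_of_mem_grassmannian hk hw' h1
    have g6 := inv_lt_inv_of_mem_grassmannian hk hw' h2
    rw [hinv, hinv, rb, rc c h1 h2] at g5
    rw [hinv, hinv, ra, rc c h1 h2] at g6
    have hl : w⁻¹ c < -k := by
      -- If `c` were a `u`, it would precede `a` in `w` but follow the `b` that replaces it in `w'`;
      -- if it were a `v`, the entry changing from `b` to `a` gives the same contradiction.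
      refine pc.2.2.2.resolve_left fun hpos => ?_
      rcases le_or_gt (w⁻¹ c) k with hle | hgt
      · clear g3 g6
        omega
      · clear g4 g5
        omega
    exact ⟨by omega, -w⁻¹ c, ⟨by omega, by omega⟩, by rw [hw.1.1, perm_apply_inv_self]⟩
  have hbpos : 0 < w⁻¹ b := by omega
  clear g1 g2
  rcases le_or_gt (w⁻¹ b) k with hbk | hbk
  · refine .inr (.inr ⟨⟨by omega, by omega⟩, ⟨by omega, by omega⟩, hb, hba,
      perm_apply_inv_self _ _, hwa, fun c ⟨h1, h2⟩ => ?_⟩)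
    have pc := inv_apply_of_mem_grassmannian hk hw (x := c) (by omega) (by omega)
    have g3 := inv_lt_inv_of_mem_grassmannian hk hw h1
    have g4 := inv_lt_inv_of_mem_grassmannian hk hw (neg_lt_neg h2)
    have g5 := inv_lt_inv_of_mem_grassmannian hk hw' (neg_lt_neg h1)
    have g6 := inv_lt_inv_of_mem_grassmannian hk hw' h2
    rw [hinv, hinv, rn, rn, rb, rc c h1 h2] at g5
    rw [hinv, hinv, ra, rc c h1 h2] at g6
    have hv : k < w⁻¹ c := by
      by_contra! hle
      rcases pc.2.2.2 with hpos | hneg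
      · clear g4 g5
        omega
      · clear g3 g6
        omega
    exact ⟨by omega, w⁻¹ c, ⟨hv, pc.2.2.1⟩, perm_apply_inv_self _ _⟩
  · have hab : b = a - 1 := by
      by_contra hne
      obtain ⟨c, h1, h2⟩ : ∃ c, b < c ∧ c < a := ⟨a - 1, by omega, by omega⟩
      have hC : |c| ≤ n := by rw [abs_le]; omega
      have pc := inv_apply_of_mem_grassmannian hk hw (x := c) (by omega) (by omega)
      have g3 := inv_lt_inv_of_mem_grassmannian hk hw h1
      have g4 := inv_lt_inv_of_mem_grassmannian hk hw (neg_lt_neg h2)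
      have g5 := inv_lt_inv_of_mem_grassmannian hk hw' h2
      have g6 := inv_lt_inv_of_mem_grassmannian hk hw' (neg_lt_neg h1)
      rw [hinv, hinv, ra, rc c h1 h2] at g5
      rw [hinv, hinv, rn, rn, rb, rc c h1 h2] at g6
      -- Block order in `w` and `w'` excludes `c` from the `λ`'s and the `v`'s. With `c` a `u`,
      -- conjugating `refl b c` by `refl c a` shows a drop of three.
      have hu : 0 < w⁻¹ c ∧ w⁻¹ c ≤ k := by omega
      clear g3 g4 g5 g6
      have r1 : refl c a a = c := by
        rw [refl_apply (by omega) (by omega)]; split_ifs <;> omega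
      have r2 : refl c a c = a := by
        rw [refl_apply (by omega) (by omega)]; split_ifs <;> omega
      have r3 : refl c a b = b := by
        rw [refl_apply (by omega) (by omega)]; split_ifs <;> omega
      have r4 : refl b c a = a := by
        rw [refl_apply (by omega) (by omega)]; split_ifs <;> omega
      have r5 : refl b c c = b := by
        rw [refl_apply (by omega) (by omega)]; split_ifs <;> omega
      have := length_refl_conj_mul_add_three_le hw.1 (c := c) (d := a) (p := b)
        (q := c) (by omega) (by omega) (by omega) (by omega) hC hA hB hC h2 h1 (by omega)
        (by rw [r2, r3]; omega) (by rw [r4, r5, r1, r3]; omega)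
      rw [r2, r3] at this
      omega
    exact .inl ⟨hab, ⟨by omega, by omega⟩, ⟨by omega, by omega⟩, by omega, hwa,
      by rw [perm_apply_inv_self, hab]⟩

/-- Block order forces both `a` and `b` to be `λ`'s. Then the reflection is `refl b a` conjugated by
the sign change of `b`, and all three factors lower the length. -/
theorem not_covers_refl_neg (hk : k ≤ n) (hw : w ∈ grassmannian n k) {a b : ℤ} (hb : 0 < b)
    (hba : b < a) (han : a ≤ n) (hw' : refl (-b) a * w ∈ grassmannian n k) :
    length n w ≠ length n (refl (-b) a * w) + 1 := by
  intro hcov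
  have hA : |a| ≤ n := by rw [abs_le]; omega
  have hB : |b| ≤ n := by rw [abs_le]; omega
  have hinv := refl_mul_inv_apply (w := w) (p := -b) (q := a) (by omega) (by omega)
  have pa := inv_apply_of_mem_grassmannian hk hw (by omega) han
  have pb := inv_apply_of_mem_grassmannian hk hw hb (by omega)
  have pa' := inv_apply_of_mem_grassmannian hk hw' (by omega) han
  have pb' := inv_apply_of_mem_grassmannian hk hw' hb (by omega)
  have hlt := (length_refl_mul_lt_iff hw.1 (p := -b) (q := a) (by omega) (by omega)
    (by rwa [abs_neg]) hA (by omega)).1 (by omega)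
  have ra : refl (-b) a a = -b := by
    rw [refl_apply (by omega) (by omega)]; split_ifs <;> omega
  have rb : refl (-b) a b = -a := by
    rw [refl_apply (by omega) (by omega)]; split_ifs <;> omega
  rw [hinv a, ra] at pa'
  rw [hinv b, rb] at pb'
  have g1 := inv_lt_inv_of_mem_grassmannian hk hw (x := -b) (y := a) (by omega)
  have g2 := inv_lt_inv_of_mem_grassmannian hk hw (x := -a) (y := b) (by omega)
  have g3 := inv_lt_inv_of_mem_grassmannian hk hw (x := -a) (y := -b) (by omega)
  have hneg : w⁻¹ a < 0 ∧ w⁻¹ b < 0 := by omega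
  clear g1 g2 g3 pa' pb'
  have r1 : refl (-b) b b = -b := by
    rw [refl_apply (by omega) (by omega)]; split_ifs <;> omega
  have r2 : refl (-b) b a = a := by
    rw [refl_apply (by omega) (by omega)]; split_ifs <;> omega
  have r3 : refl b a b = a := by
    rw [refl_apply (by omega) (by omega)]; split_ifs <;> omega
  have hn₁ := refl_neg (p := -b) (q := b) (by omega) (by omega)
  have hn₂ := refl_neg (p := b) (q := a) (by omega) (by omega)
  have := length_refl_conj_mul_add_three_le hw.1 (c := -b) (d := b) (p := b)
    (q := a) (by omega) (by omega) (by omega) (by omega) (by rwa [abs_neg]) hB hB hA (by omega)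
    hba (by omega) (by rw [r1, r2]; omega) (by rw [hn₂, r3, hn₁, r2]; omega)
  rw [r1, r2] at this
  omega

end

end TypeB

theorem corollary2p3 (n k : ℕ) (hk : k ≤ n) (w : Equiv.Perm ℤ)
    (hw : w ∈ TypeB.grassmannian n k) :
    (∀ i : ℤ, TypeB.Pattern1 n k w i →
      ∃ w' ∈ TypeB.grassmannian n k,
        TypeB.HasOneLine n w' (TypeB.replaceOne w i 1) ∧ TypeB.Covers n w w') ∧
    (∀ i j a : ℤ, TypeB.Pattern2 n k w i j a →
      ∃ w' ∈ TypeB.grassmannian n k,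
        TypeB.HasOneLine n w' (TypeB.replaceTwo w i (-(a - 1)) j a) ∧ TypeB.Covers n w w') ∧
    (∀ i j a b : ℤ, TypeB.Pattern3 n k w i j a b →
      ∃ w' ∈ TypeB.grassmannian n k,
        TypeB.HasOneLine n w' (TypeB.replaceTwo w i b j a) ∧ TypeB.Covers n w w') ∧
    (∀ i j a b : ℤ, TypeB.Pattern4 n k w i j a b →
      ∃ w' ∈ TypeB.grassmannian n k,
        TypeB.HasOneLine n w' (TypeB.replaceTwo w i a j (-b)) ∧ TypeB.Covers n w w') ∧
    (∀ w' ∈ TypeB.grassmannian n k, TypeB.Covers n w w' →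
      (∃ i : ℤ, TypeB.Pattern1 n k w i ∧
        TypeB.HasOneLine n w' (TypeB.replaceOne w i 1)) ∨
      (∃ i j a : ℤ, TypeB.Pattern2 n k w i j a ∧
        TypeB.HasOneLine n w' (TypeB.replaceTwo w i (-(a - 1)) j a)) ∨
      (∃ i j a b : ℤ, TypeB.Pattern3 n k w i j a b ∧
        TypeB.HasOneLine n w' (TypeB.replaceTwo w i b j a)) ∨
      (∃ i j a b : ℤ, TypeB.Pattern4 n k w i j a b ∧
        TypeB.HasOneLine n w' (TypeB.replaceTwo w i a j (-b)))) := by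
  refine ⟨fun i h => ?_, fun i j a h => ?_, fun i j a b h => ?_, fun i j a b h => ?_,
    fun w' hw' hcov => ?_⟩
  · obtain ⟨hg, hc⟩ := h.covers hk hw
    exact ⟨_, hg, h.hasOneLine hw.1, hc⟩
  · obtain ⟨hg, hc⟩ := h.covers hk hw
    exact ⟨_, hg, h.hasOneLine hw.1, hc⟩
  · obtain ⟨hg, hc⟩ := h.covers hk hw
    exact ⟨_, hg, h.hasOneLine hw.1 hk, hc⟩
  · obtain ⟨hg, hc⟩ := h.covers hk hw
    exact ⟨_, hg, h.hasOneLine hw.1, hc⟩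
  · obtain ⟨p, q, hp, hq, hpq, rfl⟩ := hcov.exists_refl
    -- Deleting a letter gives no explicit bound on `p` and `q`; membership of the reflection in the
    -- group supplies it.
    have hr : TypeB.refl p q ∈ TypeB.hyperoctahedral n :=
      (Subgroup.mul_mem_cancel_right _ hw.1).1 hw'.1
    rcases TypeB.refl_normal_form hp hq hpq hr with ⟨a, ha, han, h⟩ | ⟨a, b, hb, hba, han, h⟩ |
      ⟨a, b, hb, hba, han, h⟩ <;> rw [h] at hw' hcov ⊢
    · obtain ⟨rfl, hpat⟩ := TypeB.exists_pattern1_of_covers hk hw ha han hw' hcov.2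
      exact .inl ⟨_, hpat, hpat.hasOneLine hw.1⟩
    · rcases TypeB.exists_pattern_of_covers hk hw hb hba han hw' hcov.2 with
        ⟨rfl, hpat⟩ | hpat | hpat
      · exact .inr (.inl ⟨_, _, _, hpat, hpat.hasOneLine hw.1⟩)
      · exact .inr (.inr (.inl ⟨_, _, _, _, hpat, hpat.hasOneLine hw.1 hk⟩))
      · exact .inr (.inr (.inr ⟨_, _, _, _, hpat, hpat.hasOneLine hw.1⟩))
    · exact absurd hcov.2 (TypeB.not_covers_refl_neg hk hw hb hba han hw')
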